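/- For a partition $\lambda$ and a box $(i,j)$ of its Young diagram, the hook length $h(i,j)$ is the number of boxes in row $i$ strictly to the right of $(i,j)$, plus the number of boxes in column $j$ strictly below $(i,j)$, plus $1$. For a positive integer $t$, $\lambda$ is a $t$-core if no box of its Young diagram has hook length $t$, and $\lambda$ is an $(s,s+1,\dots,s+p)$-core if it is a $t$-core for every $t\in\{s,s+1,\dots,s+p\}$. A corner of $\lambda$ is a box of its Young diagram with no box directly to its right and no box directly below it. **Theorem.** Let $s,p,k$ be positive integers with $p\ge 2$ and $1\le k\le\lfloor s/2\rfloor$. Then the number of $(s,s+1,\dots,s+p)$-core partitions (of any size) with exactly $k$ corners is finite and equals $$\sum_{\ell=0}^{r} N(k,\ell+1)\binom{s-\ell(p-2)}{2k},$$ where $N(k,\ell+1)=\frac1k\binom{k}{\ell+1}\binom{k}{\ell}$ is the Narayana number, and $r=\min\left(k-1,\left\lfloor\frac{s-2k}{p-2}\right\rfloor\right)$ if $p\ge 3$, while $r=k-1$ if $p=2$. -/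

import Mathlib

/-- The hook length of the box `c = (i, j)` (0-indexed row and column) of the Young diagram `μ`:
the number of boxes of row `i` strictly to the right of `c`, plus the number of boxes of column `j`
strictly below `c`, plus one for the box `c` itself. -/
def hookLength (μ : YoungDiagram) (c : ℕ × ℕ) : ℕ :=
  (μ.rowLen c.1 - (c.2 + 1)) + (μ.colLen c.2 - (c.1 + 1)) + 1

/-- A partition is a `t`-core if no box of its Young diagram has hook length `t`. -/
def IsCore (t : ℕ) (μ : YoungDiagram) : Prop :=
  ∀ c ∈ μ.cells, hookLength μ c ≠ t

/-- A partition is an `(s, s+1, …, s+p)`-core if it is a `t`-core for each `t = s, s+1, …, s+p`. -/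
def IsConsecutiveCore (s p : ℕ) (μ : YoungDiagram) : Prop :=
  ∀ i ≤ p, IsCore (s + i) μ

/-- The corners of a Young diagram: the boxes with no box directly to the right and no box
directly below. -/
def corners (μ : YoungDiagram) : Finset (ℕ × ℕ) :=
  μ.cells.filter fun c => (c.1, c.2 + 1) ∉ μ.cells ∧ (c.1 + 1, c.2) ∉ μ.cells

/-- The Narayana number `N(n, m) = (1 / n) * C(n, m) * C(n, m - 1)`, with `N(n, 0) = 0`. -/
def narayana (n : ℕ) : ℕ → ℚ
  | 0 => 0
  | m + 1 => (1 / (n : ℚ)) * (n.choose (m + 1) : ℚ) * (n.choose m : ℚ)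

/-- `r = min (k - 1, ⌊(s - 2k) / (p - 2)⌋)`, where for `p = 2` the second entry is `∞`, so that
`r = k - 1`. It is used only for `1 ≤ k`, `2k ≤ s` and `2 ≤ p`. -/
def upperIndex (s p k : ℕ) : ℕ :=
  if p = 2 then k - 1 else min (k - 1) ((s - 2 * k) / (p - 2))

/-! Record a partition by its Maya diagram, the set `A` of beads in `ℤ`; the other integers are
holes. Hook lengths are the differences bead minus hole over pairs with the bead above the hole. So
a `t`-core is an `A` closed under `n ↦ n - t`, and corners are beads `n` with `n - 1` a hole.

Count pairs (core, corner), that is `k` times the wanted number. Translating the marked corner to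
the origin loses nothing. Closure under `-s` lets `A` be stored as `c` with `n + s * m ∈ A ↔ m < c
n`, so `c (n + s) = c n - 1`; the other closures become `c n ≤ c (n - j) + 1` for `j ≤ p`. Thus
steps of `c` rise by at most 1, and two rises with only level steps between them are at distance at
least `p` (`window_iff`). Each rise modulo `s` crosses from 0 to 1 exactly once, so `k` is the
number of rises per period (`ncard_crossings`).

Cutting at the marked rise leaves words of length `s - 1` with `k - 1` rises and total descent `k +
1`, hence `k` gaps between rises. With `x` for length and `y` for descent, a gap is either at least
`p - 1` level steps, `x^(p-1)/(1-x)`, or contains a descent, `xy/((1-x)(1-x-y))`. Expanding the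
`k`-th power of the sum by the number `l` of gaps without descent, the coefficient is `∑ C(k,l)
C(k,l+1) C(s-l(p-2),2k)`; division by `k` gives the Narayana numbers. -/

namespace YoungDiagram

/-! ### Maya diagrams of partitions -/

/-- The position of the `i`-th bead of the Maya diagram of `μ`. -/
def bead (μ : YoungDiagram) (i : ℕ) : ℤ := μ.rowLen i - i - 1

/-- The position of the `j`-th hole of the Maya diagram of `μ`. -/
def hole (μ : YoungDiagram) (j : ℕ) : ℤ := j - μ.colLen j

theorem bead_strictAnti (μ : YoungDiagram) : StrictAnti μ.bead := by
  intro i j hij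
  have := μ.rowLen_anti i j hij.le
  simp only [bead]
  omega

/-- Bead minus hole is `(rowLen i - j) + (colLen j - i) - 1`, where both brackets are positive
inside the diagram and both are nonpositive outside. -/
theorem mem_iff_hole_lt_bead (μ : YoungDiagram) (i j : ℕ) :
    (i, j) ∈ μ ↔ μ.hole j < μ.bead i := by
  have h1 := μ.mem_iff_lt_rowLen (i := i) (j := j)
  have h2 := μ.mem_iff_lt_colLen (i := i) (j := j)
  by_cases h : (i, j) ∈ μ
  · have := h1.1 h; have := h2.1 h
    simp only [h, bead, hole, true_iff]; omega
  · have := mt h1.2 h; have := mt h2.2 h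
    simp only [h, bead, hole, false_iff]; omega

theorem bead_ne_hole (μ : YoungDiagram) (i j : ℕ) : μ.bead i ≠ μ.hole j := by
  have h1 := μ.mem_iff_lt_rowLen (i := i) (j := j)
  have h2 := μ.mem_iff_lt_colLen (i := i) (j := j)
  simp only [bead, hole]
  by_cases h : (i, j) ∈ μ
  · have := h1.1 h; have := h2.1 h
    omega
  · have := mt h1.2 h; have := mt h2.2 h
    omega

theorem rowLen_eventually_zero (μ : YoungDiagram) : ∃ N, ∀ i ≥ N, μ.rowLen i = 0 := by
  refine ⟨μ.colLen 0, fun i hi => ?_⟩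
  by_contra h
  have : (i, 0) ∈ μ := μ.mem_iff_lt_rowLen.2 (Nat.pos_of_ne_zero h)
  have := μ.mem_iff_lt_colLen.1 this
  omega

theorem exists_bead_or_hole (μ : YoungDiagram) (n : ℤ) :
    (∃ i, μ.bead i = n) ∨ ∃ j, μ.hole j = n := by
  classical
  have hex : ∃ i, μ.bead i ≤ n := by
    refine ⟨(μ.rowLen 0 - n).toNat, ?_⟩
    have := μ.rowLen_anti 0 (μ.rowLen 0 - n).toNat (Nat.zero_le _)
    simp only [bead]
    omega
  obtain ⟨i, hi, hmin⟩ : ∃ i, μ.bead i ≤ n ∧ ∀ i' < i, n < μ.bead i' :=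
    ⟨Nat.find hex, Nat.find_spec hex, fun i' h => not_le.1 (Nat.find_min hex h)⟩
  rcases hi.eq_or_lt with hi | hi
  · exact Or.inl ⟨i, hi⟩
  · right
    have hi' : (μ.rowLen i : ℤ) ≤ n + i := by simp only [bead] at hi; omega
    -- Exactly `i` beads lie above `n`, so the column sought has length `i`, and `j - i = n` forces
    -- `j = n + i`.
    refine ⟨(n + i).toNat, ?_⟩
    have h1 : ¬ (i, (n + i).toNat) ∈ μ := by
      rw [μ.mem_iff_lt_rowLen]; omega
    rw [μ.mem_iff_lt_colLen] at h1
    have h2 : i ≤ μ.colLen (n + i).toNat := by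
      rcases Nat.eq_zero_or_pos i with h0 | h0
      · omega
      · have hb := hmin (i - 1) (by omega)
        simp only [bead] at hb
        have : (i - 1, (n + i).toNat) ∈ μ := by
          rw [μ.mem_iff_lt_rowLen]; omega
        rw [μ.mem_iff_lt_colLen] at this
        omega
    simp only [hole]
    omega

theorem not_mem_range_bead_iff (μ : YoungDiagram) (n : ℤ) :
    n ∉ Set.range μ.bead ↔ ∃ j, μ.hole j = n := by
  constructor
  · intro h
    exact (μ.exists_bead_or_hole n).resolve_left h
  · rintro ⟨j, hj⟩ ⟨i, hi⟩
    exact μ.bead_ne_hole i j (hi.trans hj.symm)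

theorem hookLength_eq {μ : YoungDiagram} {i j : ℕ} (h : (i, j) ∈ μ) :
    (hookLength μ (i, j) : ℤ) = μ.bead i - μ.hole j := by
  have h1 := μ.mem_iff_lt_rowLen.1 h
  have h2 := μ.mem_iff_lt_colLen.1 h
  simp only [hookLength, bead, hole]
  omega

theorem isCore_iff (μ : YoungDiagram) {t : ℕ} (ht : 0 < t) :
    IsCore t μ ↔ ∀ n ∈ Set.range μ.bead, n - t ∈ Set.range μ.bead := by
  constructor
  · rintro h _ ⟨i, rfl⟩
    by_contra hn
    obtain ⟨j, hj⟩ := (μ.not_mem_range_bead_iff _).1 hn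
    have hm : (i, j) ∈ μ := by rw [mem_iff_hole_lt_bead]; omega
    refine h (i, j) hm ?_
    have := hookLength_eq hm
    omega
  · rintro h ⟨i, j⟩ hm he
    have := hookLength_eq hm
    refine (μ.not_mem_range_bead_iff (μ.bead i - t)).2 ⟨j, by omega⟩ (h _ ⟨i, rfl⟩)

theorem mem_corners_iff (μ : YoungDiagram) (i j : ℕ) :
    (i, j) ∈ corners μ ↔ μ.hole j = μ.bead i - 1 := by
  have h1 := μ.mem_iff_lt_rowLen (i := i) (j := j)
  have h2 := μ.mem_iff_lt_colLen (i := i) (j := j)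
  have h3 := μ.mem_iff_lt_rowLen (i := i) (j := j + 1)
  have h4 := μ.mem_iff_lt_colLen (i := i + 1) (j := j)
  simp only [corners, Finset.mem_filter, mem_cells, bead, hole]
  rw [h3, h4]
  constructor
  · rintro ⟨h, h5, h6⟩
    have := h1.1 h; have := h2.1 h
    omega
  · intro h
    by_cases hm : (i, j) ∈ μ
    · have := h1.1 hm; have := h2.1 hm
      refine ⟨hm, ?_, ?_⟩ <;> omega
    · have := mt h1.2 hm; have := mt h2.2 hm
      omega

theorem ncard_boundary (μ : YoungDiagram) :
    {n : ℤ | n ∈ Set.range μ.bead ∧ n - 1 ∉ Set.range μ.bead}.ncard = (corners μ).card := by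
  rw [← Set.ncard_coe_finset]
  symm
  refine Set.ncard_congr (fun c _ => μ.bead c.1) ?_ ?_ ?_
  · rintro ⟨i, j⟩ h
    rw [Finset.mem_coe, mem_corners_iff] at h
    exact ⟨⟨i, rfl⟩, (μ.not_mem_range_bead_iff _).2 ⟨j, h⟩⟩
  · rintro ⟨i, j⟩ ⟨i', j'⟩ h h' he
    have hi : i = i' := μ.bead_strictAnti.injective he
    subst hi
    simp only [corners, Finset.coe_filter, Set.mem_ofPred_eq, mem_cells, μ.mem_iff_lt_rowLen] at h h'
    have : j = j' := by omega
    rw [this]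
  · rintro n ⟨⟨i, rfl⟩, h⟩
    obtain ⟨j, hj⟩ := (μ.not_mem_range_bead_iff _).1 h
    exact ⟨(i, j), (μ.mem_corners_iff i j).2 hj, rfl⟩

theorem exists_rowLen_eq (w : ℕ → ℕ) (hw : Antitone w) (N : ℕ) (hN : ∀ i ≥ N, w i = 0) :
    ∃ μ : YoungDiagram, ∀ i, μ.rowLen i = w i := by
  let μ : YoungDiagram :=
    { cells := (Finset.range N ×ˢ Finset.range (w 0)).filter fun c => c.2 < w c.1
      isLowerSet := by
        rintro ⟨i, j⟩ ⟨i', j'⟩ ⟨h1, h2⟩ h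
        simp only [Finset.coe_filter, Finset.mem_product, Finset.mem_range, Set.mem_ofPred_eq]
          at h h1 h2 ⊢
        have := hw h1
        omega }
  refine ⟨μ, fun i => eq_of_forall_lt_iff fun j => ?_⟩
  rw [← mem_iff_lt_rowLen, ← mem_cells]
  simp only [μ, Finset.mem_filter, Finset.mem_product, Finset.mem_range]
  constructor
  · exact fun h => h.2
  · intro h
    refine ⟨⟨?_, h.trans_le (hw (Nat.zero_le i))⟩, h⟩
    by_contra hi
    have := hN i (by omega)
    omega

/-- A strictly decreasing enumeration is determined by its range, and far out both sequences of
beads are `-i - 1`, which excludes a shift. -/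
theorem eq_of_bead_translate {μ ν : YoungDiagram} {q : ℤ}
    (h : ∀ n, n ∈ Set.range μ.bead ↔ n + q ∈ Set.range ν.bead) : q = 0 ∧ μ = ν := by
  have key : (fun i => - μ.bead i) = fun i => - (ν.bead i - q) := by
    refine (StrictMono.range_inj (fun i j hij => ?_) (fun i j hij => ?_)).1 ?_
    · have := μ.bead_strictAnti hij; omega
    · have := ν.bead_strictAnti hij; omega
    · ext n
      constructor
      · rintro ⟨i, rfl⟩
        obtain ⟨j, hj⟩ := (h _).1 ⟨i, rfl⟩
        exact ⟨j, by simp only; omega⟩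
      · rintro ⟨i, rfl⟩
        obtain ⟨j, hj⟩ := (h (ν.bead i - q)).2 ⟨i, by omega⟩
        exact ⟨j, by simp only; omega⟩
  obtain ⟨M, hM⟩ := μ.rowLen_eventually_zero
  obtain ⟨N, hN⟩ := ν.rowLen_eventually_zero
  have hq : q = 0 := by
    have h1 := congrFun key (max M N)
    have h2 := hM (max M N) (le_max_left _ _)
    have h3 := hN (max M N) (le_max_right _ _)
    simp only [bead, h2, h3] at h1
    omega
  refine ⟨hq, ?_⟩
  ext ⟨i, j⟩
  rw [mem_cells, mem_cells, mem_iff_lt_rowLen, mem_iff_lt_rowLen]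
  have h1 := congrFun key i
  simp only [bead] at h1
  omega

theorem exists_bead_translate {A : Set ℤ} (hlow : ∃ a, ∀ n < a, n ∈ A)
    (hup : ∃ b, ∀ n ∈ A, n < b) :
    ∃ (μ : YoungDiagram) (q : ℤ), ∀ n, n ∈ A ↔ n + q ∈ Set.range μ.bead := by
  obtain ⟨a, ha⟩ := hlow
  obtain ⟨b, hb⟩ := hup
  -- Elements of `A` are listed downwards from `b - 1`; `e i` is the depth of the `i`-th one.
  set P : ℕ → Prop := fun m => b - 1 - m ∈ A with hP
  have hPm : ∀ m : ℕ, (b - a).toNat ≤ m → P m := fun m hm => ha _ (by omega)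
  have hinf : {m | P m}.Infinite := by
    refine Set.infinite_of_not_bddAbove ?_
    rintro ⟨M, hM⟩
    have := hM (hPm (M + 1 + (b - a).toNat) (by omega))
    omega
  set e : ℕ → ℕ := Nat.nth P with he
  have hmono : StrictMono e := Nat.nth_strictMono hinf
  have hrange : Set.range e = {m | P m} := Nat.range_nth_of_infinite hinf
  have hid : ∀ i, i ≤ e i := fun i => hmono.le_apply
  have hbound : ∀ i, e i ≤ i + (b - a).toNat := by
    intro i
    induction i with
    | zero =>
      obtain ⟨j, hj⟩ : (b - a).toNat ∈ Set.range e := by rw [hrange]; simpa using hPm _ le_rfl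
      have := hmono.monotone (Nat.zero_le j)
      omega
    | succ i ih =>
      obtain ⟨j, hj⟩ : i + 1 + (b - a).toNat ∈ Set.range e := by
        rw [hrange]; exact hPm _ (by omega)
      have hij : i < j := hmono.lt_iff_lt.1 (by omega)
      have := hmono.monotone (Nat.succ_le_of_lt hij)
      simp only [Nat.succ_eq_add_one] at this
      omega
  have hm : Monotone fun i => e i - i := by
    refine monotone_nat_of_le_succ fun i => ?_
    have := hmono (Nat.lt_succ_self i)
    simp only [Nat.succ_eq_add_one] at this
    omega
  -- `e i - i` counts the holes above the `i`-th bead and below `b`. Its limit `Q` is the number of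
  -- all holes below `b`, so `Q - (e i - i)` counts the holes below that bead, which is the row
  -- length.
  obtain ⟨Q, N, hQ⟩ := converges_of_monotone_of_bounded hm (c := (b - a).toNat)
    (fun i => by have := hbound i; omega)
  have hQle : ∀ i, e i - i ≤ Q := fun i => by
    have h1 : e i - i ≤ e (max i N) - max i N := hm (le_max_left i N)
    have h2 : e (max i N) - max i N = Q := hQ (max i N) (le_max_right i N)
    omega
  obtain ⟨μ, hμ⟩ := exists_rowLen_eq (fun i => Q - (e i - i))
    (fun i j hij => Nat.sub_le_sub_left (hm hij) Q) N
    (fun i hi => by have := hQ i hi; omega)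
  have hbead : ∀ i, μ.bead i = Q - e i - 1 := by
    intro i
    have h1 := hQle i
    have h2 := hid i
    simp only [bead, hμ]
    omega
  refine ⟨μ, Q - b, fun n => ?_⟩
  constructor
  · intro hn
    have hlt := hb n hn
    obtain ⟨i, hi⟩ : (b - 1 - n).toNat ∈ Set.range e := by
      rw [hrange, Set.mem_ofPred_eq, hP]
      convert hn using 1
      omega
    exact ⟨i, by rw [hbead]; omega⟩
  · rintro ⟨i, hi⟩
    rw [hbead] at hi
    have : P (e i) := by
      have : e i ∈ {m | P m} := by rw [← hrange]; exact ⟨i, rfl⟩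
      simpa using this
    rw [hP] at this
    convert this using 1
    omega

end YoungDiagram

/-! ### Marking a corner -/

/-- The Maya diagrams of simultaneous cores with `k` corners, translated so that a marked corner
sits at the origin. -/
def markedMaya (s p k : ℕ) : Set (Set ℤ) :=
  {A | (∃ a, ∀ n < a, n ∈ A) ∧ (∃ b, ∀ n ∈ A, n < b) ∧ 0 ∈ A ∧ -1 ∉ A ∧
    (∀ n ∈ A, ∀ i ≤ p, n - (s + i : ℕ) ∈ A) ∧ {n | n ∈ A ∧ n - 1 ∉ A}.ncard = k}

/-- The simultaneous cores with `k` corners. -/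
def coresWithCorners (s p k : ℕ) : Set YoungDiagram :=
  {μ | IsConsecutiveCore s p μ ∧ (corners μ).card = k}

theorem ncard_translate (S : Set ℤ) (q : ℤ) : {n | n + q ∈ S}.ncard = S.ncard := by
  refine Set.ncard_congr (fun n _ => n + q) (fun n h => by simpa using h)
    (fun a b _ _ h => by simpa using h) (fun b hb => ⟨b - q, by simpa using hb, by simp⟩)

theorem bijOn_markedMaya (s p k : ℕ) (hs : 1 ≤ s) :
    Set.BijOn (fun x : YoungDiagram × (ℕ × ℕ) =>
        {n : ℤ | n + x.1.bead x.2.1 ∈ Set.range x.1.bead})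
      {x | x.1 ∈ coresWithCorners s p k ∧ x.2 ∈ corners x.1} (markedMaya s p k) := by
  refine ⟨?_, ?_, ?_⟩
  · rintro ⟨μ, i, j⟩ ⟨⟨hc, hk⟩, hij⟩
    simp only at hc hk hij
    obtain ⟨N, hN⟩ := μ.rowLen_eventually_zero
    rw [YoungDiagram.mem_corners_iff] at hij
    simp only [markedMaya, Set.mem_ofPred_eq]
    refine ⟨⟨-N - μ.bead i, fun n hn => ?_⟩, ⟨μ.bead 0 - μ.bead i + 1, ?_⟩, ⟨i, by simp⟩, ?_, ?_, ?_⟩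
    · refine ⟨(-1 - n - μ.bead i).toNat, ?_⟩
      have := hN (-1 - n - μ.bead i).toNat (by omega)
      rw [YoungDiagram.bead, this]
      omega
    · rintro n ⟨i', hi'⟩
      have := μ.bead_strictAnti.antitone (Nat.zero_le i')
      omega
    · exact (μ.not_mem_range_bead_iff _).2 ⟨j, by omega⟩
    · intro n hn t ht
      have := (μ.isCore_iff (by omega)).1 (hc t ht) _ hn
      convert this using 1
      ring
    · rw [← hk, ← YoungDiagram.ncard_boundary, ← ncard_translate {n | n ∈ Set.range μ.bead ∧ _} (μ.bead i)]
      congr 1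
      ext n
      simp only [Set.mem_ofPred_eq, sub_add_eq_add_sub]
  · rintro ⟨μ, i, j⟩ ⟨-, hij⟩ ⟨ν, i', j'⟩ ⟨-, hij'⟩ h
    simp only at hij hij' h
    have h' : ∀ n, n ∈ Set.range μ.bead ↔ n + (ν.bead i' - μ.bead i) ∈ Set.range ν.bead := by
      intro n
      have := Set.ext_iff.1 h (n - μ.bead i)
      simp only [Set.mem_ofPred_eq, sub_add_cancel] at this
      rw [this]
      have e : n - μ.bead i + ν.bead i' = n + (ν.bead i' - μ.bead i) := by ring
      rw [e]
    obtain ⟨hq, rfl⟩ := YoungDiagram.eq_of_bead_translate h'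
    obtain rfl : i' = i := μ.bead_strictAnti.injective (by omega)
    simp only [corners, Finset.mem_filter, YoungDiagram.mem_cells, μ.mem_iff_lt_rowLen]
      at hij hij'
    have : j = j' := by omega
    rw [this]
  · rintro A ⟨hlow, hup, h0, h1, hcore, hk⟩
    obtain ⟨μ, q, hμ⟩ := YoungDiagram.exists_bead_translate hlow hup
    obtain ⟨i, hi⟩ := (hμ 0).1 h0
    obtain ⟨j, hj⟩ := (μ.not_mem_range_bead_iff _).1 (mt (hμ (-1)).2 h1)
    have hA : A = {n : ℤ | n + μ.bead i ∈ Set.range μ.bead} := by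
      ext n
      rw [hμ, hi, zero_add]
      rfl
    refine ⟨(μ, i, j), ⟨⟨fun t ht => ?_, ?_⟩, ?_⟩, hA.symm⟩
    · rw [μ.isCore_iff (by omega)]
      intro n hn
      have := hcore (n - q) ((hμ _).2 (by simpa using hn)) t ht
      rw [hμ] at this
      convert this using 1
      ring
    · rw [← hk, ← YoungDiagram.ncard_boundary, ← ncard_translate _ q]
      congr 1
      ext n
      simp only [Set.mem_ofPred_eq, hμ, sub_add_eq_add_sub]
    · exact (μ.mem_corners_iff i j).2 (by omega)

/-! ### Height functions -/

/-- The height functions encoding the elements of `markedMaya`. -/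
def heights (s p k : ℕ) : Set (ℤ → ℤ) :=
  {c | (∀ n, c (n + s) = c n - 1) ∧ c 0 = 1 ∧ c (-1) = 0 ∧
    (∀ n, ∀ j ≤ p, c n ≤ c (n - (j : ℕ)) + 1) ∧ {n | 0 < c n ∧ c (n - 1) ≤ 0}.ncard = k}

theorem height_add_mul {s : ℕ} {c : ℤ → ℤ} (hc : ∀ n, c (n + s) = c n - 1) (n q : ℤ) :
    c (n + s * q) = c n - q := by
  induction q using Int.induction_on with
  | zero => simp
  | succ q ih => rw [mul_add, mul_one, ← add_assoc, hc, ih]; ring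
  | pred q ih =>
    have := hc (n + s * (-q - 1))
    have e : n + s * (-q - 1) + s = n + s * (-(q : ℤ)) := by ring
    rw [e, ih] at this
    linarith

/-- On each residue class modulo `s` the set is a down-set, and the height records where it stops.
Closure under `s + j` then says that the topmost element over `n` still lies in the set after being
moved down by `s + j`. -/
theorem bijOn_heights (s p k : ℕ) (hs : 1 ≤ s) (hp : 1 ≤ p) :
    Set.BijOn (fun c : ℤ → ℤ => {n : ℤ | 0 < c n}) (heights s p k) (markedMaya s p k) := by
  refine ⟨?_, ?_, ?_⟩
  · rintro c ⟨hper, h0, h1, hwin, hk⟩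
    have hper' := height_add_mul hper
    have hbd : ∃ M : ℤ, ∀ r : ℕ, r < s → |c r| ≤ M := by
      refine ⟨∑ r ∈ Finset.range s, |c r|, fun r hr => ?_⟩
      exact Finset.single_le_sum (f := fun r : ℕ => |c r|) (fun _ _ => abs_nonneg _)
        (Finset.mem_range.2 hr)
    obtain ⟨M, hM⟩ := hbd
    have hdecomp : ∀ n : ℤ, ∃ r : ℕ, r < s ∧ n = r + s * (n / s) ∧ c n = c r - n / s := by
      intro n
      have hs' : (0 : ℤ) < s := by omega
      have h1 := Int.emod_nonneg n hs'.ne'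
      have h2 := Int.emod_lt_of_pos n hs'
      have h3 := Int.emod_add_mul_ediv n s
      refine ⟨(n % s).toNat, by omega, by rw [Int.toNat_of_nonneg h1]; omega, ?_⟩
      rw [← hper', Int.toNat_of_nonneg h1, h3]
    refine ⟨⟨-(s * (M + 1)), fun n hn => ?_⟩, ⟨s * (M + 1), fun n hn => ?_⟩, ?_, ?_, ?_, ?_⟩
    · obtain ⟨r, hr, h3, h4⟩ := hdecomp n
      have := abs_le.1 (hM r hr)
      simp only [Set.mem_ofPred_eq]
      have : n / s < -M := by nlinarith
      linarith
    · obtain ⟨r, hr, h3, h4⟩ := hdecomp n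
      have := abs_le.1 (hM r hr)
      simp only [Set.mem_ofPred_eq] at hn
      have h5 : n / s < M := by linarith
      nlinarith
    · simp [h0]
    · simp [h1]
    · intro n hn i hi
      simp only [Set.mem_ofPred_eq] at hn ⊢
      have h5 := hwin n i hi
      have h6 := hper (n - (s + i : ℕ))
      have e : n - (s + i : ℕ) + s = n - i := by push_cast; ring
      rw [e] at h6
      linarith
    · rw [← hk]
      congr 1
      ext n
      simp
  · rintro c ⟨hper, -⟩ c' ⟨hper', -⟩ h
    have hp1 := height_add_mul hper
    have hp2 := height_add_mul hper'
    funext n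
    refine eq_of_forall_lt_iff fun m => ?_
    have := Set.ext_iff.1 h (n + s * m)
    simp only [Set.mem_ofPred_eq, hp1, hp2, sub_pos] at this
    exact this
  · rintro A ⟨⟨a, ha⟩, ⟨b, hb⟩, h0, h1, hcore, hk⟩
    have hs' : (1 : ℤ) ≤ s := by omega
    have hdown : ∀ n m m' : ℤ, m' ≤ m → n + s * m ∈ A → n + s * m' ∈ A := by
      intro n m m' hm h
      obtain ⟨d, rfl⟩ := Int.le.dest hm
      induction d generalizing m' with
      | zero => simpa using h
      | succ d ih =>
        have := hcore _ (ih (m' + 1) (by omega) (by push_cast at h ⊢; convert h using 3; ring)) 0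
          (Nat.zero_le _)
        convert this using 1
        push_cast
        ring
    have hex : ∀ n : ℤ, ∃ v : ℤ, ∀ m, m < v ↔ n + s * m ∈ A := by
      intro n
      obtain ⟨v, hv, hmax⟩ := Int.exists_greatest_of_bdd (P := fun m => n + s * m ∈ A)
        ⟨|b| + |n|, fun m hm => by
          have h2 := hb _ hm
          have h3 := le_abs_self b
          have h4 := neg_abs_le n
          have h5 := abs_nonneg b
          have h6 := abs_nonneg n
          nlinarith⟩
        ⟨-(|a| + |n| + 1), ha _ (by
          have h3 := neg_abs_le a
          have h4 := le_abs_self n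
          have h5 := abs_nonneg a
          have h6 := abs_nonneg n
          nlinarith)⟩
      exact ⟨v + 1, fun m => ⟨fun h => hdown n v m (by omega) hv,
        fun h => by have := hmax m h; omega⟩⟩
    choose c hc using hex
    have hc0 : ∀ n, 0 < c n ↔ n ∈ A := fun n => by rw [hc]; simp
    have hwin : ∀ n, ∀ j ≤ p, c n ≤ c (n - (j : ℕ)) + 1 := by
      intro n j hj
      have h2 := hcore _ ((hc n (c n - 1)).1 (by omega)) j hj
      have h3 := (hc (n - (j : ℕ)) (c n - 2)).2 (by convert h2 using 1; push_cast; ring)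
      omega
    have hm1 : c (-1) ≤ 0 := not_lt.1 (mt (hc0 _).1 h1)
    have hz := (hc0 0).2 h0
    -- `c (-1) ≤ 0 < c 0` and a step rises by at most 1, so both values are forced.
    have hw := hwin 0 1 hp
    simp only [Nat.cast_one, zero_sub] at hw
    refine ⟨c, ⟨fun n => ?_, by omega, by omega, hwin, ?_⟩, ?_⟩
    · refine eq_of_forall_lt_iff fun m => ?_
      rw [hc, lt_sub_iff_add_lt, hc]
      have e : n + s + s * m = n + s * (m + 1) := by ring
      rw [e]
    · rw [← hk]
      congr 1
      ext n
      simp only [Set.mem_ofPred_eq, ← hc0, not_lt]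
    · ext n
      exact hc0 n

/-! ### The window condition as a regular language -/

/-- The automaton recognising step codes: the letter `0` is a rise, `1` a level step and `e + 2` a
descent by `e + 1`. The state is the number of level steps still required before the next rise,
which is reset to `b` by a rise and to `0` by a descent. -/
def Accepts (b : ℕ) : ℕ → List ℕ → Prop
  | r, [] => r = 0
  | r, 0 :: L => r = 0 ∧ Accepts b b L
  | r, 1 :: L => Accepts b (r - 1) L
  | _, (_ + 2) :: L => Accepts b 0 L

/-- The rise at `i + n`, just past the word, accounts for the final requirement that the state be 0;
`r` carries what is still owed by a rise before the word. -/
theorem accepts_map_range' (b : ℕ) (a : ℕ → ℕ) (n i r : ℕ) (ha : a (i + n) = 0) :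
    Accepts b r ((List.range' i n).map a) ↔
      (∀ y, i ≤ y → y ≤ i + n → a y = 0 → (∀ z, i ≤ z → z < y → a z = 1) → i + r ≤ y) ∧
      ∀ x y, i ≤ x → x < y → y ≤ i + n → a x = 0 → a y = 0 → (∀ z, x < z → z < y → a z = 1) →
        x + b + 1 ≤ y := by
  induction n generalizing i r with
  | zero =>
    simp only [List.range'_zero, List.map_nil, Accepts]
    constructor
    · rintro rfl
      exact ⟨fun y h1 _ _ _ => by omega, fun x y h1 h2 h3 => by omega⟩
    · rintro ⟨h, -⟩
      have := h i le_rfl (by omega) ha (fun z h1 h2 => by omega)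
      omega
  | succ n ih =>
    have ih' := fun r => ih (i + 1) r (by rw [← ha]; congr 1; omega)
    rw [List.range'_succ, List.map_cons]
    rcases h : a i with _ | _ | e
    · rw [Accepts, ih']
      constructor
      · rintro ⟨rfl, h1, h2⟩
        refine ⟨fun y hy _ _ _ => by omega, fun x y hx hxy hy ax ay hz => ?_⟩
        rcases hx.eq_or_lt with rfl | hx
        · have := h1 y (by omega) (by omega) ay (fun z _ _ => hz z (by omega) (by omega))
          omega
        · exact h2 x y (by omega) hxy (by omega) ax ay hz
      · rintro ⟨h1, h2⟩
        refine ⟨?_, fun y hy hy' ay hz => ?_, fun x y hx hxy hy ax ay hz => ?_⟩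
        · have := h1 i le_rfl (by omega) h (fun z _ _ => by omega)
          omega
        · have := h2 i y le_rfl (by omega) (by omega) h ay
            (fun z _ _ => hz z (by omega) (by omega))
          omega
        · exact h2 x y (by omega) hxy (by omega) ax ay hz
    · rw [zero_add, Accepts, ih']
      constructor
      · rintro ⟨h1, h2⟩
        refine ⟨fun y hy hy' ay hz => ?_, fun x y hx hxy hy ax ay hz => ?_⟩
        · have hne : i ≠ y := by rintro rfl; omega
          have := h1 y (by omega) (by omega) ay (fun z _ _ => hz z (by omega) (by omega))
          omega
        · have hne : i ≠ x := by rintro rfl; omega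
          exact h2 x y (by omega) hxy (by omega) ax ay hz
      · rintro ⟨h1, h2⟩
        refine ⟨fun y hy hy' ay hz => ?_, fun x y hx hxy hy ax ay hz => ?_⟩
        · have := h1 y (by omega) (by omega) ay (fun z hz1 hz2 => by
            rcases hz1.eq_or_lt with rfl | hz1
            · omega
            · exact hz z (by omega) hz2)
          omega
        · exact h2 x y (by omega) hxy (by omega) ax ay hz
    · rw [Accepts, ih']
      constructor
      · rintro ⟨h1, h2⟩
        refine ⟨fun y hy hy' ay hz => ?_, fun x y hx hxy hy ax ay hz => ?_⟩
        · have hne : i ≠ y := by rintro rfl; omega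
          have := hz i le_rfl (by omega)
          omega
        · have hne : i ≠ x := by rintro rfl; omega
          exact h2 x y (by omega) hxy (by omega) ax ay hz
      · rintro ⟨h1, h2⟩
        exact ⟨fun y hy hy' ay hz => by omega,
          fun x y hx hxy hy ax ay hz => h2 x y (by omega) hxy (by omega) ax ay hz⟩

/-- The words of length `n` accepted from the state `r` with `k` rises and total descent `m`. -/
def wordSet (b n r k m : ℕ) : Set (List ℕ) :=
  {L | L.length = n ∧ L.count 0 = k ∧ (L.map Nat.pred).sum = m ∧ Accepts b r L}

theorem eq_of_level {c : ℤ → ℤ} {x y : ℤ} (h : ∀ z, x < z → z < y → c z = c (z - 1)) (z : ℤ)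
    (hx : x ≤ z) (hy : z < y) : c z = c x := by
  induction z, hx using Int.leInduction with
  | base => rfl
  | succ z hz ih =>
    rw [h (z + 1) (by omega) hy, add_sub_cancel_right]
    exact ih (by omega)

/-- A rise, level steps and another rise gain 2 in total. Conversely, in a shortest window gaining
at least 2, minimality makes the end steps rises and all steps between them level. -/
theorem window_iff {p : ℕ} (c : ℤ → ℤ) (hstep : ∀ n, c n ≤ c (n - 1) + 1) :
    (∀ n, ∀ j ≤ p, c n ≤ c (n - (j : ℕ)) + 1) ↔
      ∀ x y : ℤ, x < y → c x = c (x - 1) + 1 → c y = c (y - 1) + 1 →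
        (∀ z, x < z → z < y → c z = c (z - 1)) → x + p ≤ y := by
  constructor
  · intro h x y hxy hx hy hz
    by_contra hlt
    have h1 := eq_of_level hz (y - 1) (by omega) (by omega)
    have h2 := h y (y - x + 1).toNat (by omega)
    have e : y - ((y - x + 1).toNat : ℕ) = x - 1 := by omega
    rw [e] at h2
    omega
  · intro h
    by_contra! hcon
    classical
    have hex : ∃ j : ℕ, ∃ n, c (n - j) + 1 < c n := by
      obtain ⟨n, j, -, hj⟩ := hcon
      exact ⟨j, n, hj⟩
    obtain ⟨n, hn⟩ := Nat.find_spec hex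
    have hle : Nat.find hex ≤ p := by
      obtain ⟨n, j, hj, hj'⟩ := hcon
      exact (Nat.find_min' hex ⟨n, hj'⟩).trans hj
    have hmin : ∀ x y : ℤ, x ≤ y → y - x < Nat.find hex → c y ≤ c x + 1 := by
      intro x y hxy hlt
      have h1 := Nat.find_min hex (m := (y - x).toNat) (by omega)
      push Not at h1
      have h2 := h1 y
      have e : y - ((y - x).toNat : ℕ) = x := by omega
      rwa [e] at h2
    generalize Nat.find hex = j at hn hle hmin
    have hj : 2 ≤ j := by
      by_contra hj
      interval_cases j
      · simp at hn
      · have := hstep n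
        simp only [Nat.cast_one] at hn
        omega
    have e : n - j + 1 - 1 = n - j := by ring
    have h1 := hstep (n - j + 1)
    rw [e] at h1
    have h2 := hstep n
    have h3 := hmin (n - j + 1) n (by omega) (by omega)
    have h4 := hmin (n - j) (n - 1) (by omega) (by omega)
    have := h (n - j + 1) n (by omega) (by rw [e]; omega) (by omega) (fun z hz1 hz2 => by
      have h5 := hmin (n - j) z (by omega) (by omega)
      have h6 := hmin z n (by omega) (by omega)
      have h7 := hmin (n - j) (z - 1) (by omega) (by omega)
      have h8 := hmin (z - 1) n (by omega) (by omega)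
      omega)
    omega

/-! ### One period as a word -/

/-- The letter encoding the step of a height function arriving at `i`. -/
def stepCode (c : ℤ → ℤ) (i : ℕ) : ℕ := (1 - (c i - c (i - 1))).toNat

/-- The word encoding one period of a height function. -/
def heightWord (s : ℕ) (c : ℤ → ℤ) : List ℕ := (List.range' 1 (s - 1)).map (stepCode c)

theorem stepCode_cast {c : ℤ → ℤ} (hstep : ∀ n, c n ≤ c (n - 1) + 1) (i : ℕ) :
    (stepCode c i : ℤ) = 1 - (c i - c (i - 1)) := by
  have := hstep i
  rw [stepCode]
  omega

/-- The marked rise at 0 recurs at `s`: it sets the initial state to `p - 1` and closes the word. -/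
theorem window_iff_accepts {s p : ℕ} (hs : 1 ≤ s) (hp : 1 ≤ p) {c : ℤ → ℤ}
    (hper : ∀ n, c (n + s) = c n - 1) (h0 : c 0 = 1) (h1 : c (-1) = 0)
    (hstep : ∀ n, c n ≤ c (n - 1) + 1) :
    (∀ n, ∀ j ≤ p, c n ≤ c (n - (j : ℕ)) + 1) ↔ Accepts (p - 1) (p - 1) (heightWord s c) := by
  have hcode := stepCode_cast hstep
  have hper' := height_add_mul hper
  have hcs : c s = c (s - 1) + 1 := by
    have e1 := hper 0
    have e2 := hper (-1)
    rw [zero_add] at e1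
    have e : (-1 : ℤ) + s = s - 1 := by ring
    rw [e] at e2
    omega
  have hs0 : stepCode c (1 + (s - 1)) = 0 := by
    have e : 1 + (s - 1) = s := by omega
    have := hcode s
    rw [e]
    omega
  rw [window_iff c hstep, heightWord, accepts_map_range' _ _ _ _ _ hs0]
  constructor
  · intro h
    refine ⟨fun y hy hy' ay hz => ?_, fun x y hx hxy hy ax ay hz => ?_⟩
    · have := hcode y
      have := h 0 y (by omega) (by simp [h0, h1]) (by omega) (fun z hz1 hz2 => by
        have h2 := hz z.toNat (by omega) (by omega)
        have h3 := hcode z.toNat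
        rw [Int.toNat_of_nonneg (by omega)] at h3
        omega)
      omega
    · have := hcode y
      have := hcode x
      have := h x y (by omega) (by omega) (by omega) (fun z hz1 hz2 => by
        have h2 := hz z.toNat (by omega) (by omega)
        have h3 := hcode z.toNat
        rw [Int.toNat_of_nonneg (by omega)] at h3
        omega)
      omega
  · rintro ⟨hA, hB⟩ x y hxy hx hy hz
    have hs' : (0 : ℤ) < s := by omega
    obtain ⟨q, hq0, hqs⟩ : ∃ q : ℤ, 0 ≤ x + s * q ∧ x + s * q < s := by
      refine ⟨-(x / s), ?_⟩
      have h2 := Int.emod_nonneg x hs'.ne'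
      have h3 := Int.emod_lt_of_pos x hs'
      have h4 := Int.emod_add_mul_ediv x s
      constructor <;> linarith
    have hsh : ∀ n, c n = c (n + s * q) + q := fun n => by rw [hper']; ring
    have hsh' : ∀ n, c (n - 1) = c (n + s * q - 1) + q := fun n => by
      rw [hsh (n - 1)]
      congr 2
      ring
    rw [hsh, hsh' x] at hx
    rw [hsh, hsh' y] at hy
    have hz' : ∀ z, x + s * q < z → z < y + s * q → c z = c (z - 1) := by
      intro z hz1 hz2
      have h2 := hz (z - s * q) (by omega) (by omega)
      rw [hsh, hsh' (z - s * q), sub_add_cancel] at h2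
      omega
    generalize hX : x + s * q = X at *
    generalize hY : y + s * q = Y at *
    -- Otherwise the rise at `s` would lie strictly between `X` and `Y`, where all steps are level.
    have hYs : Y ≤ s := by
      by_contra hlt
      have := hz' s hqs (by omega)
      omega
    have hzN : ∀ z : ℕ, X < z → (z : ℤ) < Y → stepCode c z = 1 := by
      intro z hz1 hz2
      have h2 := hz' z hz1 hz2
      have h3 := hcode z
      omega
    have hYc := hcode Y.toNat
    rw [Int.toNat_of_nonneg (by omega)] at hYc
    rcases hq0.eq_or_lt with hX0 | hX0
    · have := hA Y.toNat (by omega) (by omega) (by omega)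
        (fun z hz1 hz2 => hzN z (by omega) (by omega))
      omega
    · have hXc := hcode X.toNat
      rw [Int.toNat_of_nonneg (by omega)] at hXc
      have := hB X.toNat Y.toNat (by omega) (by omega) (by omega) (by omega) (by omega)
        (fun z hz1 hz2 => hzN z (by omega) (by omega))
      omega

theorem count_zero_map_range' (a : ℕ → ℕ) (n : ℕ) :
    ((List.range' 1 n).map a).count 0 = ∑ i ∈ Finset.range n, if a (i + 1) = 0 then 1 else 0 := by
  induction n with
  | zero => simp
  | succ n ih =>
    rw [List.range'_1_concat, List.map_append, List.count_append, ih, Finset.sum_range_succ,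
      add_comm 1 n]
    simp [List.count_singleton]

theorem sum_pred_map_range' (a : ℕ → ℕ) (n : ℕ) :
    (((List.range' 1 n).map a).map Nat.pred).sum = ∑ i ∈ Finset.range n, (a (i + 1)).pred := by
  induction n with
  | zero => simp
  | succ n ih =>
    rw [List.range'_1_concat, List.map_append, List.map_append, List.sum_append, ih,
      Finset.sum_range_succ, add_comm 1 n]
    simp

theorem sum_one_sub_eq (a : ℕ → ℕ) (n : ℕ) :
    ∑ i ∈ Finset.range n, (1 - (a (i + 1) : ℤ)) =
      ((List.range' 1 n).map a).count 0 - (((List.range' 1 n).map a).map Nat.pred).sum := by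
  rw [count_zero_map_range', sum_pred_map_range']
  push_cast
  rw [← Finset.sum_sub_distrib]
  refine Finset.sum_congr rfl fun i _ => ?_
  rcases a (i + 1) with _ | e <;> simp

/-- From `c 0 = 1` to `c (s - 1) = c (-1) - 1 = -1` the net change is `-2`. -/
theorem sum_pred_heightWord {s : ℕ} (hs : 1 ≤ s) {c : ℤ → ℤ}
    (hper : ∀ n, c (n + s) = c n - 1) (h0 : c 0 = 1) (h1 : c (-1) = 0)
    (hstep : ∀ n, c n ≤ c (n - 1) + 1) :
    ((heightWord s c).map Nat.pred).sum = (heightWord s c).count 0 + 2 := by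
  have h := sum_one_sub_eq (stepCode c) (s - 1)
  have h2 : ∑ i ∈ Finset.range (s - 1), (1 - (stepCode c (i + 1) : ℤ)) = c (s - 1 : ℕ) - c 0 := by
    have := Finset.sum_range_sub (fun i : ℕ => c i) (s - 1)
    rw [Nat.cast_zero] at this
    rw [← this]
    refine Finset.sum_congr rfl fun i _ => ?_
    rw [stepCode_cast hstep]
    push_cast
    rw [add_sub_cancel_right]
    ring
  have h3 := hper (-1)
  have e : (-1 : ℤ) + s = (s - 1 : ℕ) := by omega
  rw [e] at h3
  rw [h2] at h
  simp only [heightWord]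
  omega

/-- Translating by `s` lowers the height by 1, so exactly one translate of each rise goes from 0 to
1. The extra 1 is the marked rise, which the word omits. -/
theorem ncard_crossings {s : ℕ} (hs : 1 ≤ s) {c : ℤ → ℤ}
    (hper : ∀ n, c (n + s) = c n - 1) (h0 : c 0 = 1) (h1 : c (-1) = 0)
    (hstep : ∀ n, c n ≤ c (n - 1) + 1) :
    {n | 0 < c n ∧ c (n - 1) ≤ 0}.ncard = (heightWord s c).count 0 + 1 := by
  have hcode := stepCode_cast hstep
  have hper' := height_add_mul hper
  have hs' : (0 : ℤ) < s := by omega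
  have h2 : (heightWord s c).count 0 + 1 =
      ((Finset.range s).filter fun i => stepCode c i = 0).card := by
    rw [heightWord, count_zero_map_range', Finset.card_filter]
    obtain ⟨t, rfl⟩ : ∃ t, s = t + 1 := ⟨s - 1, by omega⟩
    rw [Finset.sum_range_succ', Nat.add_sub_cancel]
    have := hcode 0
    simp only [Nat.cast_zero, zero_sub] at this
    rw [if_pos (by omega)]
  rw [h2, ← Set.ncard_coe_finset]
  have hstepsh : ∀ n q : ℤ, c (n + s * q - 1) = c (n - 1) - q := fun n q => by
    rw [← hper']
    congr 1
    ring
  refine Set.ncard_congr (fun n _ => (n % s).toNat) ?_ ?_ ?_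
  · rintro n ⟨hn1, hn2⟩
    have h3 := Int.emod_nonneg n hs'.ne'
    have h4 := Int.emod_lt_of_pos n hs'
    have h5 := Int.emod_add_mul_ediv n s
    have h6 := hper' (n % s) (n / s)
    have h7 := hstepsh (n % s) (n / s)
    rw [h5] at h6 h7
    have h8 := hcode (n % s).toNat
    have h9 := hstep n
    rw [Int.toNat_of_nonneg h3] at h8
    simp only [Finset.coe_filter, Finset.mem_range, Set.mem_ofPred_eq]
    omega
  · rintro m n ⟨hm1, hm2⟩ ⟨hn1, hn2⟩ h
    have h3 := Int.emod_nonneg n hs'.ne'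
    have h3' := Int.emod_nonneg m hs'.ne'
    have e : m % s = n % s := by
      have h : (m % s).toNat = (n % s).toNat := h
      omega
    have h5 := Int.emod_add_mul_ediv n s
    have h5' := Int.emod_add_mul_ediv m s
    have h6 := hper' (n % s) (n / s)
    have h6' := hper' (m % s) (m / s)
    rw [h5] at h6
    rw [h5', e] at h6'
    have h9 := hstep n
    have h9' := hstep m
    have : m / s = n / s := by omega
    rw [← h5, ← h5', e, this]
  · rintro i hi
    simp only [Finset.coe_filter, Finset.mem_range, Set.mem_ofPred_eq] at hi
    have h3 := hcode i
    refine ⟨i + s * (c i - 1), ?_, ?_⟩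
    · simp only [Set.mem_ofPred_eq]
      rw [hper', hstepsh]
      omega
    · simp only [Int.add_mul_emod_self_left]
      rw [Int.emod_eq_of_lt (by omega) (by omega)]
      simp

theorem mem_heights_iff {s p k : ℕ} (hs : 1 ≤ s) (hp : 1 ≤ p) (hk : 1 ≤ k) {c : ℤ → ℤ}
    (hper : ∀ n, c (n + s) = c n - 1) (h0 : c 0 = 1) (h1 : c (-1) = 0)
    (hstep : ∀ n, c n ≤ c (n - 1) + 1) :
    c ∈ heights s p k ↔ heightWord s c ∈ wordSet (p - 1) (s - 1) (p - 1) (k - 1) (k + 1) := by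
  have h2 := sum_pred_heightWord hs hper h0 h1 hstep
  have h3 := ncard_crossings hs hper h0 h1 hstep
  have h4 := window_iff_accepts hs hp hper h0 h1 hstep
  simp only [heights, wordSet, Set.mem_ofPred_eq]
  rw [h2, h3, h4]
  constructor
  · rintro ⟨-, -, -, h5, h6⟩
    exact ⟨by simp [heightWord], by omega, by omega, h5⟩
  · rintro ⟨-, h5, -, h6⟩
    exact ⟨hper, h0, h1, h6, by omega⟩

theorem exists_height_of_word {s : ℕ} (hs : 1 ≤ s) (L : List ℕ) (hlen : L.length = s - 1)
    (hL : (L.map Nat.pred).sum = L.count 0 + 2) :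
    ∃ c : ℤ → ℤ, (∀ n, c (n + s) = c n - 1) ∧ c 0 = 1 ∧ c (-1) = 0 ∧
      (∀ n, c n ≤ c (n - 1) + 1) ∧ heightWord s c = L := by
  have hs' : (0 : ℤ) < s := by omega
  obtain ⟨a, ha⟩ : ∃ a : ℕ → ℕ, L = (List.range' 1 (s - 1)).map a := by
    refine ⟨fun i => L.getD (i - 1) 0, List.ext_getElem (by simp [hlen]) fun i h1 h2 => ?_⟩
    simp [List.getElem?_eq_getElem h1]
  set H : ℕ → ℤ := fun i => 1 + ∑ t ∈ Finset.range i, (1 - (a (t + 1) : ℤ)) with hH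
  -- This makes the step closing the period a rise from 0 to 1.
  have hHs : H (s - 1) = -1 := by
    rw [hH]
    simp only
    rw [sum_one_sub_eq, ← ha, hL]
    push_cast
    ring
  have hH1 : ∀ i, H (i + 1) = H i + (1 - (a (i + 1) : ℤ)) := fun i => by
    simp only [hH, Finset.sum_range_succ, add_assoc]
  set c : ℤ → ℤ := fun n => H (n % s).toNat - n / s with hc
  have hcr : ∀ i : ℕ, ∀ q : ℤ, i < s → c (i + s * q) = H i - q := by
    intro i q hi
    simp only [hc, Int.add_mul_emod_self_left, Int.add_mul_ediv_left _ _ hs'.ne']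
    rw [Int.emod_eq_of_lt (by omega) (by omega), Int.ediv_eq_zero_of_lt (by omega) (by omega)]
    simp
  have hcr0 : ∀ i : ℕ, i < s → c i = H i := fun i hi => by
    have := hcr i 0 hi
    simpa using this
  have hper : ∀ n, c (n + s) = c n - 1 := by
    intro n
    have e : n + s = n + s * 1 := by ring
    simp only [hc]
    rw [e, Int.add_mul_emod_self_left, Int.add_mul_ediv_left _ _ hs'.ne']
    ring
  have h0 : c 0 = 1 := by
    have := hcr0 0 (by omega)
    rw [Nat.cast_zero] at this
    rw [this]
    simp [hH]
  have hm1 : c (-1) = 0 := by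
    have := hcr (s - 1) (-1) (by omega)
    rw [hHs] at this
    have e : ((s - 1 : ℕ) : ℤ) + s * (-1) = -1 := by omega
    rw [e] at this
    omega
  have hdiff : ∀ i : ℕ, i + 1 < s → c (i + 1 : ℕ) = c i + (1 - (a (i + 1) : ℤ)) := fun i hi => by
    rw [hcr0 _ hi, hcr0 _ (by omega), hH1]
  refine ⟨c, hper, h0, hm1, fun n => ?_, ?_⟩
  · have hper' := height_add_mul hper
    have h3 := Int.emod_nonneg n hs'.ne'
    have h4 := Int.emod_lt_of_pos n hs'
    have h5 := Int.emod_add_mul_ediv n s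
    have h6 := hper' (n % s) (n / s)
    have h7 := hper' (n % s - 1) (n / s)
    have e : n % s - 1 + s * (n / s) = n - 1 := by omega
    rw [h5] at h6
    rw [e] at h7
    rw [h6, h7]
    obtain ⟨i, hi⟩ : ∃ i : ℕ, n % s = i := ⟨(n % s).toNat, by omega⟩
    rw [hi]
    rcases i with _ | i
    · simp [h0, hm1]
    · have := hdiff i (by omega)
      have e : ((i + 1 : ℕ) : ℤ) - 1 = i := by push_cast; ring
      rw [e]
      omega
  · rw [ha, heightWord]
    refine List.map_congr_left fun i hi => ?_
    rw [List.mem_range'_1] at hi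
    obtain ⟨t, rfl⟩ : ∃ t, i = t + 1 := ⟨i - 1, by omega⟩
    have := hdiff t (by omega)
    have e : ((t + 1 : ℕ) : ℤ) - 1 = t := by push_cast; ring
    rw [stepCode, e]
    omega

theorem bijOn_heightWord {s p k : ℕ} (hs : 1 ≤ s) (hp : 1 ≤ p) (hk : 1 ≤ k) :
    Set.BijOn (heightWord s) (heights s p k)
      (wordSet (p - 1) (s - 1) (p - 1) (k - 1) (k + 1)) := by
  have hstep : ∀ c ∈ heights s p k, ∀ n, c n ≤ c (n - 1) + 1 := by
    rintro c ⟨-, -, -, h, -⟩ n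
    simpa using h n 1 hp
  refine ⟨?_, ?_, ?_⟩
  · intro c hc
    obtain ⟨hper, h0, h1, -, -⟩ := id hc
    exact (mem_heights_iff hs hp hk hper h0 h1 (hstep c hc)).1 hc
  · intro c hc c' hc' h
    have hs1 := stepCode_cast (hstep c hc)
    have hs2 := stepCode_cast (hstep c' hc')
    obtain ⟨hper, h0, -⟩ := hc
    obtain ⟨hper', h0', -⟩ := hc'
    have hcode : ∀ i, 1 ≤ i → i < s → stepCode c i = stepCode c' i := fun i h1 h2 =>
      List.map_inj_left.1 h i (by rw [List.mem_range'_1]; omega)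
    have heq : ∀ i : ℕ, i < s → c i = c' i := by
      intro i
      induction i with
      | zero => intro _; simp [h0, h0']
      | succ i ih =>
        intro hi
        have h1 := hcode (i + 1) (by omega) hi
        have h2 := hs1 (i + 1)
        have h3 := hs2 (i + 1)
        have h4 := ih (by omega)
        have e : ((i + 1 : ℕ) : ℤ) - 1 = i := by push_cast; ring
        rw [e] at h2 h3
        omega
    funext n
    have hs' : (0 : ℤ) < s := by omega
    have h3 := Int.emod_nonneg n hs'.ne'
    have h4 := Int.emod_lt_of_pos n hs'
    have h5 := Int.emod_add_mul_ediv n s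
    have h6 := height_add_mul hper (n % s) (n / s)
    have h7 := height_add_mul hper' (n % s) (n / s)
    have h8 := heq (n % s).toNat (by omega)
    rw [Int.toNat_of_nonneg h3] at h8
    rw [h5] at h6 h7
    omega
  · rintro L hL
    obtain ⟨hlen, hcount, hsum, -⟩ := id hL
    obtain ⟨c, hper, h0, h1, hst, rfl⟩ := exists_height_of_word hs L hlen (by omega)
    exact ⟨c, (mem_heights_iff hs hp hk hper h0 h1 hst).2 hL, rfl⟩

/-! ### Recursive enumeration of the words -/

/-- The finite set of words of length `n` accepted from the state `r` with `k` rises and total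
descent `m`. -/
def words (b : ℕ) : ℕ → ℕ → ℕ → ℕ → Finset (List ℕ)
  | 0, r, k, m => if r = 0 ∧ k = 0 ∧ m = 0 then {[]} else ∅
  | n + 1, r, k, m =>
    ((words b n (r - 1) k m).image (List.cons 1) ∪
      if r = 0 ∧ 0 < k then (words b n b (k - 1) m).image (List.cons 0) else ∅) ∪
      (Finset.range m).biUnion fun e => (words b n 0 k e).image (List.cons (m - e - 1 + 2))

theorem coe_words (b n r k m : ℕ) : (words b n r k m : Set (List ℕ)) = wordSet b n r k m := by
  ext L
  rw [Finset.mem_coe]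
  induction n generalizing r k m L with
  | zero =>
    simp only [words, wordSet, Set.mem_ofPred_eq, List.length_eq_zero_iff]
    constructor
    · intro h
      split_ifs at h with h'
      · obtain ⟨rfl, rfl, rfl⟩ := h'
        rw [Finset.mem_singleton] at h
        subst h
        simp [Accepts]
      · simp at h
    · rintro ⟨rfl, h1, h2, h3⟩
      simp only [Accepts] at h3
      simp at h1 h2
      rw [if_pos ⟨h3, h1.symm, h2.symm⟩]
      simp
  | succ n ih =>
    have hite : (L ∈ if r = 0 ∧ 0 < k then (words b n b (k - 1) m).image (List.cons 0) else ∅) ↔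
        (r = 0 ∧ 0 < k) ∧ L ∈ (words b n b (k - 1) m).image (List.cons 0) := by
      split_ifs with h <;> simp [h]
    simp only [words, Finset.mem_union, hite, Finset.mem_biUnion, Finset.mem_image, ih,
      Finset.mem_range]
    simp only [wordSet, Set.mem_ofPred_eq]
    constructor
    · rintro ((⟨T, ⟨h1, h2, h3, h4⟩, rfl⟩ | ⟨⟨h5, h6⟩, T, ⟨h1, h2, h3, h4⟩, rfl⟩) |
        ⟨e, he, T, ⟨h1, h2, h3, h4⟩, rfl⟩)
      · refine ⟨by simp [h1], by simp [h2], by simp [h3], by simpa [Accepts] using h4⟩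
      · refine ⟨by simp [h1], by simp [h2]; omega, by simp [h3], ?_⟩
        rw [Accepts]
        exact ⟨h5, h4⟩
      · refine ⟨by simp [h1], by simp [h2], ?_, ?_⟩
        · simp [h3]; omega
        · rw [Accepts]
          exact h4
    · rintro ⟨h1, h2, h3, h4⟩
      rcases L with _ | ⟨a, T⟩
      · simp at h1
      simp only [List.length_cons, Nat.add_right_cancel_iff] at h1
      simp only [List.map_cons, List.sum_cons] at h3
      rcases a with _ | _ | a
      · rw [Accepts] at h4
        simp only [List.count_cons_self] at h2
        simp only [Nat.pred_zero, zero_add] at h3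
        exact Or.inl (Or.inr ⟨⟨h4.1, by omega⟩, T, ⟨h1, by omega, h3, h4.2⟩, rfl⟩)
      · rw [zero_add, Accepts] at h4
        rw [List.count_cons_of_ne (by omega)] at h2
        simp only [Nat.pred_succ, zero_add] at h3
        exact Or.inl (Or.inl ⟨T, ⟨h1, h2, h3, h4⟩, rfl⟩)
      · rw [Accepts] at h4
        rw [List.count_cons_of_ne (by omega)] at h2
        simp only [Nat.pred_succ] at h3
        refine Or.inr ⟨(T.map Nat.pred).sum, by omega, T, ⟨h1, h2, rfl, h4⟩, ?_⟩
        congr 1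
        omega

theorem card_words_zero (b r k m : ℕ) :
    (words b 0 r k m).card = if r = 0 ∧ k = 0 ∧ m = 0 then 1 else 0 := by
  rw [words]
  split_ifs <;> rfl

theorem card_words_succ (b n r k m : ℕ) :
    (words b (n + 1) r k m).card = (words b n (r - 1) k m).card +
      (if r = 0 ∧ 0 < k then (words b n b (k - 1) m).card else 0) +
      ∑ e ∈ Finset.range m, (words b n 0 k e).card := by
  have hinj : ∀ a : ℕ, Function.Injective (List.cons a) := fun a => List.cons_injective
  rw [words, Finset.card_union_of_disjoint, Finset.card_union_of_disjoint,
    Finset.card_image_of_injective _ (hinj 1), Finset.card_biUnion]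
  · congr 1
    · congr 1
      split_ifs
      · rw [Finset.card_image_of_injective _ (hinj 0)]
      · rfl
    · exact Finset.sum_congr rfl fun e _ => Finset.card_image_of_injective _ (hinj _)
  · intro e he e' he' hne
    rw [Function.onFun, Finset.disjoint_left]
    intro L h h'
    obtain ⟨T, -, rfl⟩ := Finset.mem_image.1 h
    obtain ⟨T', -, h2⟩ := Finset.mem_image.1 h'
    rw [Finset.mem_coe, Finset.mem_range] at he he'
    injection h2
    omega
  · split_ifs
    · rw [Finset.disjoint_left]
      intro L h h'
      obtain ⟨T, -, rfl⟩ := Finset.mem_image.1 h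
      obtain ⟨T', -, h2⟩ := Finset.mem_image.1 h'
      injection h2
      omega
    · exact Finset.disjoint_empty_right _
  · rw [Finset.disjoint_left]
    intro L h h'
    obtain ⟨e, -, h'⟩ := Finset.mem_biUnion.1 h'
    obtain ⟨T', -, rfl⟩ := Finset.mem_image.1 h'
    rcases Finset.mem_union.1 h with h | h
    · obtain ⟨T, -, h2⟩ := Finset.mem_image.1 h
      injection h2
      omega
    · split_ifs at h
      · obtain ⟨T, -, h2⟩ := Finset.mem_image.1 h
        injection h2
        omega
      · simp at h

/-! ### Generating function -/

open PowerSeries in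
/-- The generating function of the accepted words with `k` rises: the outer variable records the
total descent, the inner one the length. -/
noncomputable def wordSeries (b r k : ℕ) : ℤ⟦X⟧⟦X⟧ :=
  mk fun m => mk fun n => ((words b n r k m).card : ℤ)

-- Split by the first letter. The factor `1 - X` clears the geometric series of possible descents;
-- `r - 1` is truncated, as a level step in state 0 changes nothing.
open PowerSeries in
theorem wordSeries_rec (b r k : ℕ) :
    (1 - X) * wordSeries b r k =
      (1 - X) * (if r = 0 ∧ k = 0 then 1 else 0) + (1 - X) * (C X * wordSeries b (r - 1) k) +
        (1 - X) * (if r = 0 ∧ 0 < k then C X * wordSeries b b (k - 1) else 0) +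
        C X * X * wordSeries b 0 k := by
  set Ψ : ℤ⟦X⟧⟦X⟧ := mk fun m => mk fun n => ∑ e ∈ Finset.range m, ((words b n 0 k e).card : ℤ)
    with hΨ
  have h1 : (1 - X) * Ψ = X * wordSeries b 0 k := by
    ext m n
    rw [sub_mul, one_mul]
    rcases m with _ | m
    · simp [hΨ]
    · rw [map_sub, coeff_succ_X_mul, coeff_succ_X_mul, map_sub]
      simp [hΨ, wordSeries, Finset.sum_range_succ]
  have h2 : wordSeries b r k = (if r = 0 ∧ k = 0 then 1 else 0) + C X * wordSeries b (r - 1) k +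
      (if r = 0 ∧ 0 < k then C X * wordSeries b b (k - 1) else 0) + C X * Ψ := by
    ext m n
    simp only [map_add, coeff_C_mul]
    have e1 : coeff n (coeff m (if r = 0 ∧ 0 < k then C X * wordSeries b b (k - 1) else 0 :
        ℤ⟦X⟧⟦X⟧)) = if r = 0 ∧ 0 < k then coeff n (X * coeff m (wordSeries b b (k - 1))) else 0 := by
      split_ifs <;> simp [coeff_C_mul]
    have e2 : coeff n (coeff m (if r = 0 ∧ k = 0 then 1 else 0 : ℤ⟦X⟧⟦X⟧)) =
        if n = 0 ∧ r = 0 ∧ k = 0 ∧ m = 0 then 1 else 0 := by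
      by_cases h : r = 0 ∧ k = 0
      · rw [if_pos h, coeff_one]
        by_cases hm : m = 0
        · simp [hm, h.1, h.2, coeff_one]
        · simp [hm]
      · rw [if_neg h, if_neg (by tauto)]
        simp
    rw [e1, e2]
    rcases n with _ | n
    · simp [wordSeries, card_words_zero]
    · simp only [coeff_succ_X_mul]
      simp only [wordSeries, hΨ, coeff_mk, card_words_succ]
      push_cast
      simp
  calc (1 - X) * wordSeries b r k = (1 - X) * (if r = 0 ∧ k = 0 then 1 else 0) +
        (1 - X) * (C X * wordSeries b (r - 1) k) +
        (1 - X) * (if r = 0 ∧ 0 < k then C X * wordSeries b b (k - 1) else 0) +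
        C X * ((1 - X) * Ψ) := by
        conv_lhs => rw [h2]
        ring
    _ = _ := by rw [h1]; ring

-- With `C X` as `x` and `X` as `y`, this is a first gap owing `r` level steps, then `k` times a
-- rise followed by a gap owing `b`.
open PowerSeries in
theorem wordSeries_eq (b r k : ℕ) :
    ((1 - C X) * (1 - C X - X)) ^ (k + 1) * wordSeries b r k =
      (C X ^ r * (1 - C X - X) + C X * X) *
        (C X * (C X ^ b * (1 - C X - X) + C X * X)) ^ k := by
  have hX : (1 - X : ℤ⟦X⟧⟦X⟧) ≠ 0 := by
    intro h
    have := congrArg constantCoeff h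
    simp at this
  induction k generalizing r with
  | zero =>
    have h0 : (1 - C X - X) * wordSeries b 0 0 = 1 - X := by
      have := wordSeries_rec b 0 0
      simp only [and_self, if_true, lt_irrefl, and_false, if_false, Nat.zero_sub] at this
      linear_combination this
    induction r with
    | zero => linear_combination (1 - C X) * h0
    | succ r ih =>
      have := wordSeries_rec b (r + 1) 0
      simp only [Nat.add_eq_zero_iff, one_ne_zero, and_false, false_and, if_false,
        Nat.add_sub_cancel] at this
      refine mul_left_cancel₀ hX ?_
      linear_combination ((1 - C X) * (1 - C X - X)) * this + (1 - X) * C X * ih +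
        C X * X * (1 - C X) * h0
  | succ k ihk =>
    set E : ℤ⟦X⟧⟦X⟧ := ((1 - C X) * (1 - C X - X)) ^ (k + 1) with hE
    set Q : ℤ⟦X⟧⟦X⟧ := (C X * (C X ^ b * (1 - C X - X) + C X * X)) ^ k with hQ
    have hb := ihk b
    have h0 : (1 - C X - X) * wordSeries b 0 (k + 1) = (1 - X) * (C X * wordSeries b b k) := by
      have := wordSeries_rec b 0 (k + 1)
      simp only [Nat.succ_ne_zero, and_false, if_false, Nat.zero_sub, Nat.succ_pos, and_self,
        if_true, Nat.add_sub_cancel] at this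
      linear_combination this
    rw [pow_succ _ (k + 1), ← hE, pow_succ _ k, ← hQ]
    induction r with
    | zero => linear_combination E * (1 - C X) * h0 + (1 - C X) * (1 - X) * C X * hb
    | succ r ih =>
      have := wordSeries_rec b (r + 1) (k + 1)
      simp only [Nat.add_eq_zero_iff, one_ne_zero, and_false, false_and, if_false,
        Nat.add_sub_cancel] at this
      refine mul_left_cancel₀ hX ?_
      linear_combination (E * ((1 - C X) * (1 - C X - X))) * this + (1 - X) * C X * ih +
        C X * X * E * (1 - C X) * h0 + C X * X * (1 - C X) * (1 - X) * C X * hb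

-- `1 - x - y = (1 - x)(1 - y/(1 - x))`, with `mk 1` as `1/(1 - x)`: a geometric series rescaled by
-- `mk 1`.
open PowerSeries in
theorem one_sub_sub_pow_mul (d : ℕ) :
    (1 - C X - X : ℤ⟦X⟧⟦X⟧) ^ (d + 1) *
      mk (fun i => (mk 1 : ℤ⟦X⟧) ^ (d + 1 + i) * ((d + i).choose d : ℤ⟦X⟧)) = 1 := by
  have hV : (mk 1 : ℤ⟦X⟧) * (1 - X) = 1 := mk_one_mul_one_sub_eq_one ℤ
  have h1 : (mk (fun i => (mk 1 : ℤ⟦X⟧) ^ (d + 1 + i) * ((d + i).choose d : ℤ⟦X⟧)) : ℤ⟦X⟧⟦X⟧) =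
      (C (mk 1) * rescale (mk 1 : ℤ⟦X⟧) (mk 1)) ^ (d + 1) := by
    rw [mul_pow, ← map_pow, ← map_pow, mk_one_pow_eq_mk_choose_add ℤ⟦X⟧ d]
    refine PowerSeries.ext fun i => ?_
    rw [coeff_mk, coeff_C_mul, coeff_rescale, coeff_mk, pow_add]
    ring
  have h2 : (1 - C X - X : ℤ⟦X⟧⟦X⟧) * (C (mk 1) * rescale (mk 1 : ℤ⟦X⟧) (mk 1)) = 1 := by
    have h3 : rescale (mk 1 : ℤ⟦X⟧) ((mk 1 : ℤ⟦X⟧⟦X⟧) * (1 - X)) = 1 := by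
      rw [mk_one_mul_one_sub_eq_one, map_one]
    rw [map_mul, map_sub, map_one, rescale_X] at h3
    have h4 : (C (mk 1 : ℤ⟦X⟧) * (1 - C X) : ℤ⟦X⟧⟦X⟧) = 1 := by
      rw [← map_one (C (R := ℤ⟦X⟧)), ← map_sub, ← map_mul, hV]
    linear_combination h3 + rescale (mk 1 : ℤ⟦X⟧) (mk 1) * h4
  rw [h1, ← mul_pow, h2, one_pow]

open PowerSeries in
/-- The series with constant coefficients `(1 - x - y)⁻ʲ`, the outer variable being `y`. -/
noncomputable def invPowSeries : ℕ → ℤ⟦X⟧⟦X⟧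
  | 0 => 1
  | d + 1 => mk fun i => (mk 1 : ℤ⟦X⟧) ^ (d + 1 + i) * ((d + i).choose d : ℤ⟦X⟧)

open PowerSeries in
theorem pow_mul_invPowSeries (j : ℕ) : (1 - C X - X) ^ j * invPowSeries j = 1 := by
  rcases j with _ | d
  · simp [invPowSeries]
  · exact one_sub_sub_pow_mul d

-- Written with `choose (l + 1)`, the formula also covers `j = 0`, where it vanishes.
open PowerSeries in
theorem coeff_invPowSeries (j l : ℕ) :
    coeff (l + 1) (invPowSeries j) =
      (mk 1 : ℤ⟦X⟧) ^ (j + l + 1) * ((j + l).choose (l + 1) : ℤ⟦X⟧) := by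
  rcases j with _ | d
  · simp [invPowSeries, coeff_one]
  · rw [invPowSeries, coeff_mk]
    have e : (d + (l + 1)).choose d = (d + 1 + l).choose (l + 1) := by
      rw [Nat.choose_symm_add]
      congr 1
      omega
    rw [e]
    ring

-- The extra factor `x` pairs each of the `k + 1` gaps with a rise, giving a pure power; `l` counts
-- the gaps without a descent.
open PowerSeries in
theorem X_mul_wordSeries_eq (b k : ℕ) :
    C X * wordSeries b b k =
      ∑ l ∈ Finset.range (k + 1 + 1),
        X ^ (k + 1 - l) * (C (X ^ (k + 1 + b * l + (k + 1 - l)) * (mk 1) ^ (k + 1) *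
          ((k + 1).choose l : ℤ⟦X⟧)) * invPowSeries (k + 1 - l)) := by
  have hV : (C (mk 1 : ℤ⟦X⟧) * (1 - C X) : ℤ⟦X⟧⟦X⟧) = 1 := by
    rw [← map_one (C (R := ℤ⟦X⟧)), ← map_sub, ← map_mul, mk_one_mul_one_sub_eq_one]
  have hVk : (C (mk 1 : ℤ⟦X⟧) ^ (k + 1) * (1 - C X) ^ (k + 1) : ℤ⟦X⟧⟦X⟧) = 1 := by
    rw [← mul_pow, hV, one_pow]
  have hW := pow_mul_invPowSeries (k + 1)
  have h1 := wordSeries_eq b b k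
  have h2 : C X * wordSeries b b k = C (mk 1 : ℤ⟦X⟧) ^ (k + 1) * invPowSeries (k + 1) *
      (C X * (C X ^ b * (1 - C X - X) + C X * X)) ^ (k + 1) := by
    calc C X * wordSeries b b k = C X * wordSeries b b k *
          (C (mk 1 : ℤ⟦X⟧) ^ (k + 1) * (1 - C X) ^ (k + 1)) *
          ((1 - C X - X) ^ (k + 1) * invPowSeries (k + 1)) := by rw [hVk, hW]; ring
      _ = C (mk 1 : ℤ⟦X⟧) ^ (k + 1) * invPowSeries (k + 1) * C X *
          (((1 - C X) * (1 - C X - X)) ^ (k + 1) * wordSeries b b k) := by rw [mul_pow]; ring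
      _ = _ := by rw [h1]; ring
  rw [h2, mul_pow, add_pow, Finset.mul_sum, Finset.mul_sum]
  refine Finset.sum_congr rfl fun l hl => ?_
  obtain ⟨j, hj⟩ : ∃ j, k + 1 = l + j := ⟨k + 1 - l, by rw [Finset.mem_range] at hl; omega⟩
  have hinv : invPowSeries (k + 1) * (1 - C X - X) ^ l = invPowSeries j := by
    calc invPowSeries (k + 1) * (1 - C X - X) ^ l
        = invPowSeries (k + 1) * (1 - C X - X) ^ l *
          ((1 - C X - X) ^ j * invPowSeries j) := by rw [pow_mul_invPowSeries, mul_one]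
      _ = (1 - C X - X) ^ (k + 1) * invPowSeries (k + 1) * invPowSeries j := by
          rw [hj, pow_add]; ring
      _ = _ := by rw [hW, one_mul]
  have hj' : k + 1 - l = j := by omega
  rw [hj', ← hinv]
  simp only [map_mul, map_pow, map_natCast, mul_pow]
  ring

open PowerSeries in
theorem coeff_X_pow_mul_mk_one_pow (e d s : ℕ) :
    coeff s (X ^ e * (mk 1 : ℤ⟦X⟧) ^ (d + 1)) =
      if e ≤ s then ((d + (s - e)).choose d : ℤ) else 0 := by
  rw [coeff_X_pow_mul', mk_one_pow_eq_mk_choose_add, coeff_mk]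

open PowerSeries in
theorem card_words (p s k : ℕ) (hp : 2 ≤ p) (hk : 1 ≤ k) (hs : 1 ≤ s) :
    (words (p - 1) (s - 1) (p - 1) (k - 1) (k + 1)).card =
      ∑ l ∈ Finset.range (k + 1),
        k.choose l * k.choose (l + 1) * (s - l * (p - 2)).choose (2 * k) := by
  obtain ⟨k, rfl⟩ : ∃ k', k = k' + 1 := ⟨k - 1, by omega⟩
  obtain ⟨s, rfl⟩ : ∃ s', s = s' + 1 := ⟨s - 1, by omega⟩
  obtain ⟨b, rfl⟩ : ∃ b, p = b + 2 := ⟨p - 2, by omega⟩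
  -- After the index shifts, `k + 1 + 1` is the total descent; `s + 1` is the word length plus the
  -- extra factor `x`.
  have h := congrArg (fun F => coeff (s + 1) (coeff (k + 1 + 1) F)) (X_mul_wordSeries_eq (b + 1) k)
  simp only [coeff_C_mul, coeff_succ_X_mul, wordSeries, coeff_mk, map_sum] at h
  zify
  have e1 : b + 2 - 1 = b + 1 := rfl
  simp only [Nat.add_sub_cancel, e1]
  rw [h]
  refine Finset.sum_congr rfl fun l hl => ?_
  rw [Finset.mem_range] at hl
  have e2 : k + 1 + 1 = l + 1 + (k + 1 - l) := by omega
  rw [e2, coeff_X_pow_mul, coeff_C_mul, coeff_invPowSeries]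
  have e3 : k + 1 - l + l = k + 1 := by omega
  rw [e3]
  have e4 : (X ^ (k + 1 + (b + 1) * l + (k + 1 - l)) * (mk 1) ^ (k + 1) *
      ((k + 1).choose l : ℤ⟦X⟧) * ((mk 1) ^ (k + 1 + 1) * ((k + 1).choose (l + 1) : ℤ⟦X⟧)) : ℤ⟦X⟧) =
      C (((k + 1).choose l * (k + 1).choose (l + 1) : ℕ) : ℤ) *
        (X ^ (2 * (k + 1) + l * b) * (mk 1) ^ (2 * (k + 1) + 1)) := by
    have e5 : k + 1 + (b + 1) * l + (k + 1 - l) = 2 * (k + 1) + l * b := by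
      have : (b + 1) * l = l * b + l := by ring
      omega
    rw [e5, map_natCast]
    push_cast
    ring
  rw [e4, coeff_C_mul, coeff_X_pow_mul_mk_one_pow]
  push_cast
  congr 1
  split_ifs with hle
  · congr 2
    omega
  -- As `2 * (k + 1)` is positive, the binomial vanishes even when the subtraction truncates to 0.
  · rw [Nat.choose_eq_zero_of_lt (by omega)]
    rfl

/-! ### Double counting and the final formula -/

theorem card_mul_ncard_coresWithCorners {s p k : ℕ} (hs : 1 ≤ s) (hp : 1 ≤ p) (hk : 1 ≤ k) :
    (coresWithCorners s p k).Finite ∧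
      (coresWithCorners s p k).ncard * k = (words (p - 1) (s - 1) (p - 1) (k - 1) (k + 1)).card := by
  have hb1 := bijOn_markedMaya s p k hs
  have hb2 := bijOn_heights s p k hs hp
  have hb3 := bijOn_heightWord hs hp hk
  rw [← coe_words] at hb3
  have hfin : {x : YoungDiagram × (ℕ × ℕ) |
      x.1 ∈ coresWithCorners s p k ∧ x.2 ∈ corners x.1}.Finite :=
    hb1.finite_iff_finite.2 (hb2.finite_iff_finite.1 (hb3.finite_iff_finite.2
      (Finset.finite_toSet _)))
  have hF : (coresWithCorners s p k).Finite := by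
    refine (hfin.image Prod.fst).subset fun μ hμ => ?_
    obtain ⟨c, hc⟩ : (corners μ).Nonempty := by
      rw [← Finset.card_pos, hμ.2]
      exact hk
    exact ⟨(μ, c), ⟨hμ, hc⟩, rfl⟩
  refine ⟨hF, ?_⟩
  rw [← Set.ncard_coe_finset, ← hb3.ncard_eq, hb2.ncard_eq, ← hb1.ncard_eq,
    Set.ncard_eq_toFinset_card _ hF]
  have hS : {x : YoungDiagram × (ℕ × ℕ) | x.1 ∈ coresWithCorners s p k ∧ x.2 ∈ corners x.1}.ncard =
      (hF.toFinset.sigma corners).card := by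
    rw [← Set.ncard_coe_finset]
    refine Set.ncard_congr (fun x _ => ⟨x.1, x.2⟩) ?_ ?_ ?_
    · rintro ⟨μ, c⟩ ⟨h1, h2⟩
      simpa using ⟨h1, h2⟩
    · rintro ⟨μ, c⟩ ⟨ν, d⟩ - - h
      simpa using h
    · rintro ⟨μ, c⟩ h
      have h' : μ ∈ coresWithCorners s p k ∧ c ∈ corners μ := by simpa using h
      exact ⟨(μ, c), h', rfl⟩
  rw [hS, Finset.card_sigma, Finset.sum_congr rfl (g := fun _ => k), Finset.sum_const, smul_eq_mul]
  intro μ hμ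
  exact ((Set.Finite.mem_toFinset hF).1 hμ).2

/-- Past the upper index, either `k < l + 1` or `s - l * (p - 2) < 2 * k`, so a binomial factor is
0. -/
theorem sum_upperIndex {s p k : ℕ} (hp : 2 ≤ p) (hk : 1 ≤ k) :
    ∑ l ∈ Finset.range (k + 1), k.choose l * k.choose (l + 1) * (s - l * (p - 2)).choose (2 * k) =
      ∑ l ∈ Finset.range (upperIndex s p k + 1),
        k.choose l * k.choose (l + 1) * (s - l * (p - 2)).choose (2 * k) := by
  have hr : upperIndex s p k ≤ k - 1 := by
    rw [upperIndex]
    split_ifs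
    · rfl
    · exact min_le_left _ _
  symm
  refine Finset.sum_subset (Finset.range_subset_range.2 (by omega)) fun l _ hl => ?_
  rw [Finset.mem_range, not_lt] at hl
  by_cases hlk : k ≤ l
  · rw [Nat.choose_eq_zero_of_lt (show k < l + 1 by omega)]
    ring
  · rw [upperIndex] at hl
    split_ifs at hl with hp2
    · omega
    · have h1 : (s - 2 * k) / (p - 2) < l := by
        rcases min_choice (k - 1) ((s - 2 * k) / (p - 2)) with h | h <;> omega
      rw [Nat.div_lt_iff_lt_mul (by omega)] at h1
      rw [Nat.choose_eq_zero_of_lt (show s - l * (p - 2) < 2 * k by omega)]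
      ring

theorem mainTheorem6 (s p k : ℕ) (hs : 1 ≤ s) (hp : 2 ≤ p) (hk : 1 ≤ k) (hks : k ≤ s / 2) :
    {μ : YoungDiagram | IsConsecutiveCore s p μ ∧ (corners μ).card = k}.Finite ∧
    (({μ : YoungDiagram | IsConsecutiveCore s p μ ∧ (corners μ).card = k}.ncard : ℕ) : ℚ) =
      ∑ l ∈ Finset.range (upperIndex s p k + 1),
        narayana k (l + 1) * ((s - l * (p - 2)).choose (2 * k) : ℚ) := by
  obtain ⟨hF, hcard⟩ := card_mul_ncard_coresWithCorners hs (by omega : 1 ≤ p) hk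
  rw [card_words p s k hp hk hs, sum_upperIndex hp hk] at hcard
  refine ⟨hF, ?_⟩
  have hk0 : (k : ℚ) ≠ 0 := by
    have : k ≠ 0 := by omega
    exact_mod_cast this
  have hcard' := congrArg (Nat.cast : ℕ → ℚ) hcard
  push_cast at hcard'
  change ((coresWithCorners s p k).ncard : ℚ) = _
  rw [eq_div_of_mul_eq hk0 hcard', Finset.sum_div]
  refine Finset.sum_congr rfl fun l _ => ?_
  rw [narayana]
  ring
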